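/- Let $\mathcal{E}$ be an exact category in the sense of Quillen with enough projectives and enough injectives; let $\mathcal{P}$ and $\mathcal{I}$ denote the full subcategories of all projective and of all injective objects of $\mathcal{E}$. Let $\mathcal{M}$ be a full additive subcategory of $\mathcal{E}$ and let $k \geq 1$ be an integer. Let $\operatorname{cogen}^k_{\mathcal{E}}(\mathcal{M})$ be the full subcategory of all objects $X$ of $\mathcal{E}$ for which there is an exact sequence $0 \to X \to M_0 \to \cdots \to M_k \to Z \to 0$ in $\mathcal{E}$ (that is, a sequence spliced from conflations) with all $M_i \in \mathcal{M}$ such that for every $M \in \mathcal{M}$ the sequence of abelian groups $$\operatorname{Hom}(M_k,M) \to \cdots \to \operatorname{Hom}(M_0,M) \to \operatorname{Hom}(X,M) \to 0$$ is exact. Dually, let $\operatorname{gen}_k^{\mathcal{E}}(\mathcal{M})$ be the full subcategory of all objects $X$ for which there is an exact sequence $0 \to Z \to M_k \to \cdots \to M_0 \to X \to 0$ in $\mathcal{E}$ with all $M_i \in \mathcal{M}$ such that for every $M \in \mathcal{M}$ the sequence $$\operatorname{Hom}(M,M_k) \to \cdots \to \operatorname{Hom}(M,M_0) \to \operatorname{Hom}(M,X)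 \to 0$$ is exact. A right (resp. left) $\mathcal{M}$-module is a contravariant (resp. covariant) additive functor from $\mathcal{M}$ to abelian groups; let $\operatorname{mod}_k\text{-}\mathcal{M}$ (resp. $\mathcal{M}\text{-}\operatorname{mod}_k$) be the category of those right (resp. left) $\mathcal{M}$-modules $F$ that admit an exact sequence $Q_k \to \cdots \to Q_0 \to F \to 0$ with all $Q_i$ finitely generated projective. Then the following two statements are equivalent: (1) $\mathcal{P} \subset \operatorname{cogen}^k_{\mathcal{E}}(\mathcal{M})$, and $\operatorname{Hom}_{\mathcal{E}}(-,I)|_{\mathcal{M}} \in \operatorname{mod}_k\text{-}\mathcal{M}$ for every $I \in \mathcal{I}$. (2) $\mathcal{I} \subset \operatorname{gen}_k^{\mathcal{E}}(\mathcal{M})$, and $\operatorname{Hom}_{\mathcal{E}}(P,-)|_{\mathcal{M}} \in \mathcal{M}\text{-}\operatorname{mod}_k$ for every $P \in \mathcal{P}$. -/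

import Mathlib

open CategoryTheory CategoryTheory.Limits

universe v u

namespace SymPrinciple

section ExactCategories

variable {C : Type u} [Category.{v} C] [Preadditive C]

/-- An exact structure (in the sense of Quillen) on an additive category: a class of
kernel-cokernel pairs `X → Y → Z`, called conflations, closed under isomorphism. In a conflation
the first morphism is called an inflation and the second one a deflation. Identities are inflations
and deflations, both classes are closed under composition, inflations admit pushouts along
arbitrary morphisms and these are inflations, deflations admit pullbacks along arbitrary morphisms
and these are deflations. -/
structure ExactStructure (C : Type u) [Category.{v} C] [Preadditive C] where
  /-- the class of conflations -/
  conflation : ObjectProperty (ShortComplex C)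
  conflation_of_iso : ∀ {S T : ShortComplex C}, (S ≅ T) → conflation S → conflation T
  isKernel : ∀ {S : ShortComplex C}, conflation S →
    Nonempty (IsLimit (KernelFork.ofι S.f S.zero))
  isCokernel : ∀ {S : ShortComplex C}, conflation S →
    Nonempty (IsColimit (CokernelCofork.ofπ S.g S.zero))
  /-- the class of inflations -/
  inflation : MorphismProperty C
  inflation_iff : ∀ {X Y : C} (f : X ⟶ Y),
    inflation f ↔ ∃ (Z : C) (g : Y ⟶ Z) (w : f ≫ g = 0), conflation (ShortComplex.mk f g w)
  /-- the class of deflations -/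
  deflation : MorphismProperty C
  deflation_iff : ∀ {Y Z : C} (g : Y ⟶ Z),
    deflation g ↔ ∃ (X : C) (f : X ⟶ Y) (w : f ≫ g = 0), conflation (ShortComplex.mk f g w)
  id_inflation : ∀ X : C, inflation (𝟙 X)
  id_deflation : ∀ X : C, deflation (𝟙 X)
  comp_inflation : ∀ {X Y Z : C} (f : X ⟶ Y) (g : Y ⟶ Z),
    inflation f → inflation g → inflation (f ≫ g)
  comp_deflation : ∀ {X Y Z : C} (f : X ⟶ Y) (g : Y ⟶ Z),
    deflation f → deflation g → deflation (f ≫ g)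
  pushout_inflation : ∀ {X Y X' : C} (i : X ⟶ Y) (f : X ⟶ X'), inflation i →
    ∃ (Y' : C) (f' : Y ⟶ Y') (i' : X' ⟶ Y'), IsPushout i f f' i' ∧ inflation i'
  pullback_deflation : ∀ {Y Z Z' : C} (p : Y ⟶ Z) (f : Z' ⟶ Z), deflation p →
    ∃ (Y' : C) (f' : Y' ⟶ Y) (p' : Y' ⟶ Z'), IsPullback f' p' p f ∧ deflation p'

namespace ExactStructure

variable (E : ExactStructure C)

/-- `0 → X → Y → Z → 0` is an admissible short exact sequence. -/
def IsShortExact {X Y Z : C} (f : X ⟶ Y) (g : Y ⟶ Z) : Prop :=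
  ∃ w : f ≫ g = 0, E.conflation (ShortComplex.mk f g w)

/-- Projective objects of the exact category: they lift against deflations. -/
def projectives : ObjectProperty C := fun P =>
  ∀ ⦃Y Z : C⦄ (p : Y ⟶ Z), E.deflation p → ∀ f : P ⟶ Z, ∃ g : P ⟶ Y, g ≫ p = f

/-- Injective objects of the exact category: they extend along inflations. -/
def injectives : ObjectProperty C := fun I =>
  ∀ ⦃X Y : C⦄ (i : X ⟶ Y), E.inflation i → ∀ f : X ⟶ I, ∃ g : Y ⟶ I, i ≫ g = f

/-- Every object is the target of a deflation from a projective object. -/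
def EnoughProjectives : Prop :=
  ∀ X : C, ∃ (P : C) (p : P ⟶ X), E.projectives P ∧ E.deflation p

/-- Every object is the source of an inflation into an injective object. -/
def EnoughInjectives : Prop :=
  ∀ X : C, ∃ (I : C) (i : X ⟶ I), E.injectives I ∧ E.inflation i

/-- An exact sequence `0 → Z → N k → ⋯ → N 1 → N 0 → X → 0` in the exact category, that is, a
sequence spliced from the conflations `K 0 → N 0 → X` and `K (i + 1) → N (i + 1) → K i`, `i < k`,
with `Z = K k`. Only the terms with index at most `k` matter. -/
structure LeftSequence (k : ℕ) (X : C) where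
  N : ℕ → C
  K : ℕ → C
  ε : N 0 ⟶ X
  d : ∀ i, N (i + 1) ⟶ N i
  ι : ∀ i, K i ⟶ N i
  π : ∀ i, N (i + 1) ⟶ K i
  fac : ∀ i, i < k → π i ≫ ι i = d i
  exact_zero : E.IsShortExact (ι 0) ε
  exact_succ : ∀ i, i < k → E.IsShortExact (ι (i + 1)) (π i)

/-- An exact sequence `0 → X → N 0 → N 1 → ⋯ → N k → Z → 0` in the exact category, that is, a
sequence spliced from the conflations `X → N 0 → K 0` and `K i → N (i + 1) → K (i + 1)`, `i < k`,
with `Z = K k`. Only the terms with index at most `k` matter. -/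
structure RightSequence (k : ℕ) (X : C) where
  N : ℕ → C
  K : ℕ → C
  η : X ⟶ N 0
  d : ∀ i, N i ⟶ N (i + 1)
  π : ∀ i, N i ⟶ K i
  ι : ∀ i, K i ⟶ N (i + 1)
  fac : ∀ i, i < k → π i ≫ ι i = d i
  exact_zero : E.IsShortExact η (π 0)
  exact_succ : ∀ i, i < k → E.IsShortExact (ι i) (π (i + 1))

/-- `Hom(T, N k) → ⋯ → Hom(T, N 0) → Hom(T, X) → 0` is exact (there is no condition at
`Hom(T, N k)`). -/
structure LeftSequence.HomExact {E : ExactStructure C} {k : ℕ} {X : C} (S : E.LeftSequence k X)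
    (T : C) : Prop where
  surjective : Function.Surjective (fun g : T ⟶ S.N 0 => g ≫ S.ε)
  exact_zero : 0 < k →
    Function.Exact (fun g : T ⟶ S.N 1 => g ≫ S.d 0) (fun g : T ⟶ S.N 0 => g ≫ S.ε)
  exact_succ : ∀ i, i + 1 < k →
    Function.Exact (fun g : T ⟶ S.N (i + 2) => g ≫ S.d (i + 1))
      (fun g : T ⟶ S.N (i + 1) => g ≫ S.d i)

/-- `Hom(N k, T) → ⋯ → Hom(N 0, T) → Hom(X, T) → 0` is exact (there is no condition at
`Hom(N k, T)`). -/
structure RightSequence.HomExact {E : ExactStructure C} {k : ℕ} {X : C} (S : E.RightSequence k X)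
    (T : C) : Prop where
  surjective : Function.Surjective (fun g : S.N 0 ⟶ T => S.η ≫ g)
  exact_zero : 0 < k →
    Function.Exact (fun g : S.N 1 ⟶ T => S.d 0 ≫ g) (fun g : S.N 0 ⟶ T => S.η ≫ g)
  exact_succ : ∀ i, i + 1 < k →
    Function.Exact (fun g : S.N (i + 2) ⟶ T => S.d (i + 1) ≫ g)
      (fun g : S.N (i + 1) ⟶ T => S.d i ≫ g)

/-- The full subcategory `gen_k(M)`. -/
def gen (M : ObjectProperty C) (k : ℕ) : ObjectProperty C := fun X =>
  ∃ S : E.LeftSequence k X, (∀ i, i ≤ k → M (S.N i)) ∧ ∀ T, M T → S.HomExact T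

/-- The full subcategory `cogen^k(M)`. -/
def cogen (M : ObjectProperty C) (k : ℕ) : ObjectProperty C := fun X =>
  ∃ S : E.RightSequence k X, (∀ i, i ≤ k → M (S.N i)) ∧ ∀ T, M T → S.HomExact T

end ExactStructure

end ExactCategories

section Modules

variable {A : Type u} [Category.{v} A] [Preadditive A]

/-- A (left) `A`-module `F`, that is, an additive functor from `A` to abelian groups, is finitely
generated: finitely many elements `x i ∈ F (a i)` generate it. -/
def IsFinGen (F : A ⥤+ AddCommGrpCat.{v}) : Prop :=
  ∃ (n : ℕ) (a : Fin n → A) (x : ∀ i, F.obj.obj (a i)),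
    ∀ (b : A) (y : F.obj.obj b), ∃ f : ∀ i, a i ⟶ b, y = ∑ i, F.obj.map (f i) (x i)

/-- A `k`-presentation `P k → ⋯ → P 1 → P 0 → F → 0` of an `A`-module `F` by finitely generated
projective `A`-modules; exactness of sequences of modules is exactness at each object of `A`, and
nothing is required at `P k`. Only the terms with index at most `k` matter. -/
structure ModulePresentation (k : ℕ) (F : A ⥤+ AddCommGrpCat.{v}) where
  P : ℕ → (A ⥤+ AddCommGrpCat.{v})
  ε : P 0 ⟶ F
  d : ∀ i, P (i + 1) ⟶ P i
  finGen : ∀ i, i ≤ k → IsFinGen (P i)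
  projective : ∀ i, i ≤ k → Projective (P i)
  surjective : ∀ a : A, Function.Surjective (ε.hom.app a)
  exact_zero : 0 < k → ∀ a : A, Function.Exact ((d 0).hom.app a) (ε.hom.app a)
  exact_succ : ∀ i, i + 1 < k → ∀ a : A,
    Function.Exact ((d (i + 1)).hom.app a) ((d i).hom.app a)

/-- The category `A-mod_k` of the left `A`-modules admitting a `k`-presentation by finitely
generated projectives. For `A = Mᵒᵖ` this is the category `mod_k-M` of right `M`-modules. -/
def modK (A : Type u) [Category.{v} A] [Preadditive A] (k : ℕ) :
    ObjectProperty (A ⥤+ AddCommGrpCat.{v}) := fun F =>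
  Nonempty (ModulePresentation k F)

variable {C : Type u} [Category.{v} C] [Preadditive C] (M : ObjectProperty C)

/-- The right `M`-module `Φ(X) = Hom(-, X)|_M`. -/
noncomputable def homTo (X : C) : M.FullSubcategoryᵒᵖ ⥤+ AddCommGrpCat.{v} :=
  AdditiveFunctor.of (M.ι.op ⋙ preadditiveYoneda.obj X)

/-- The left `M`-module `Ψ(X) = Hom(X, -)|_M`. -/
noncomputable def homFrom (X : C) : M.FullSubcategory ⥤+ AddCommGrpCat.{v} :=
  AdditiveFunctor.of (M.ι ⋙ preadditiveCoyoneda.obj (Opposite.op X))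

end Modules

end SymPrinciple

/-
By duality it suffices to prove that (1) implies (2), and there the statement on
`Hom(P, -)|_M` follows by applying `Hom(-, M)` to the coresolution of `P`. Let `I` be injective.
Every morphism to `I` from an object of `cogen` factors through an object of `M`. Finite generation
of `Hom(-, I)|_M` gives a right `M`-approximation `N ⟶ I`. For a deflation `P ⟶ I` from a projective
whose coresolution starts with `P ⟶ N₀`, this factorization yields a deflation `N₀ ⟶ I`, so that
`N ⊞ N₀ ⟶ I` is a right approximation and a deflation. Its kernel `K` inherits the factorization
property, with one step of the coresolutions used up, and by Schanuel's lemma `Hom(-, K)|_M` admits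
a presentation which is shorter by one. Iterating gives the resolution of `I`.
-/

namespace SymPrinciple

section ExactCategories

variable {C : Type u} [Category.{v} C] [Preadditive C]

lemma exact_op_comp {X Y Z : C} {T : Cᵒᵖ} {d : X ⟶ Y} {e : Y ⟶ Z}
    (h : Function.Exact (fun g : T.unop ⟶ X => g ≫ d) (fun g : T.unop ⟶ Y => g ≫ e)) :
    Function.Exact (fun g : Opposite.op X ⟶ T => d.op ≫ g)
      (fun g : Opposite.op Y ⟶ T => e.op ≫ g) := by
  refine fun g => ⟨fun hg => ?_, ?_⟩
  · obtain ⟨t, ht⟩ := (h g.unop).1 (Quiver.Hom.op_inj hg)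
    exact ⟨t.op, Quiver.Hom.unop_inj ht⟩
  · rintro ⟨t, rfl⟩
    exact Quiver.Hom.unop_inj ((h _).2 ⟨t.unop, rfl⟩)

lemma exact_unop_comp {X Y Z : Cᵒᵖ} {T : C} {d : X ⟶ Y} {e : Y ⟶ Z}
    (h : Function.Exact (fun g : Opposite.op T ⟶ X => g ≫ d)
      (fun g : Opposite.op T ⟶ Y => g ≫ e)) :
    Function.Exact (fun g : X.unop ⟶ T => d.unop ≫ g) (fun g : Y.unop ⟶ T => e.unop ≫ g) := by
  refine fun g => ⟨fun hg => ?_, ?_⟩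
  · obtain ⟨t, ht⟩ := (h g.op).1 (Quiver.Hom.unop_inj hg)
    exact ⟨t.unop, Quiver.Hom.op_inj ht⟩
  · rintro ⟨t, rfl⟩
    exact Quiver.Hom.op_inj ((h _).2 ⟨t.op, rfl⟩)

namespace ExactStructure

/-- The opposite exact structure, with inflations and deflations exchanged; every statement about
deflations and right approximations yields its dual through it. -/
def op (E : ExactStructure C) : ExactStructure Cᵒᵖ where
  conflation S := E.conflation S.unop
  conflation_of_iso e h :=
    E.conflation_of_iso ((ShortComplex.unopFunctor C).mapIso e).unop.symm h
  isKernel h := ⟨CokernelCofork.IsColimit.ofπOp _ _ (E.isCokernel h).some⟩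
  isCokernel h := ⟨KernelFork.IsLimit.ofιOp _ _ (E.isKernel h).some⟩
  inflation := E.deflation.op
  inflation_iff f := by
    refine (E.deflation_iff f.unop).trans ⟨?_, ?_⟩
    · rintro ⟨X, g, w, h⟩
      exact ⟨Opposite.op X, g.op, Quiver.Hom.unop_inj w, h⟩
    · rintro ⟨X, g, w, h⟩
      exact ⟨X.unop, g.unop, Quiver.Hom.op_inj w, h⟩
  deflation := E.inflation.op
  deflation_iff f := by
    refine (E.inflation_iff f.unop).trans ⟨?_, ?_⟩
    · rintro ⟨X, g, w, h⟩
      exact ⟨Opposite.op X, g.op, Quiver.Hom.unop_inj w, h⟩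
    · rintro ⟨X, g, w, h⟩
      exact ⟨X.unop, g.unop, Quiver.Hom.op_inj w, h⟩
  id_inflation X := E.id_deflation X.unop
  id_deflation X := E.id_inflation X.unop
  comp_inflation f g hf hg := E.comp_deflation g.unop f.unop hg hf
  comp_deflation f g hf hg := E.comp_inflation g.unop f.unop hg hf
  pushout_inflation i f hi := by
    obtain ⟨Y', f', p', h, hp⟩ := E.pullback_deflation i.unop f.unop hi
    exact ⟨Opposite.op Y', f'.op, p'.op, h.op.flip, hp⟩
  pullback_deflation p f hp := by
    obtain ⟨Y', f', i', h, hi⟩ := E.pushout_inflation p.unop f.unop hp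
    exact ⟨Opposite.op Y', f'.op, i'.op, h.op.flip, hi⟩

variable {E : ExactStructure C}

lemma projectives.op {X : C} (h : E.projectives X) : E.op.injectives (Opposite.op X) := by
  intro Y Z i hi f
  obtain ⟨g, hg⟩ := h i.unop hi f.unop
  exact ⟨g.op, Quiver.Hom.unop_inj hg⟩

lemma projectives.unop {X : Cᵒᵖ} (h : E.op.projectives X) : E.injectives X.unop := by
  intro Y Z i hi f
  obtain ⟨g, hg⟩ := h i.op hi f.op
  exact ⟨g.unop, Quiver.Hom.op_inj hg⟩

lemma injectives.op {X : C} (h : E.injectives X) : E.op.projectives (Opposite.op X) := by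
  intro Y Z i hi f
  obtain ⟨g, hg⟩ := h i.unop hi f.unop
  exact ⟨g.op, Quiver.Hom.unop_inj hg⟩

lemma injectives.unop {X : Cᵒᵖ} (h : E.op.injectives X) : E.projectives X.unop := by
  intro Y Z i hi f
  obtain ⟨g, hg⟩ := h i.op hi f.op
  exact ⟨g.unop, Quiver.Hom.op_inj hg⟩

lemma EnoughInjectives.op (h : E.EnoughInjectives) : E.op.EnoughProjectives := by
  intro X
  obtain ⟨I, i, hI, hi⟩ := h X.unop
  exact ⟨Opposite.op I, i.op, hI.op, hi⟩

lemma inflation.exists_isShortExact {X Y : C} {f : X ⟶ Y} (hf : E.inflation f) :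
    ∃ (Z : C) (g : Y ⟶ Z), E.IsShortExact f g :=
  (E.inflation_iff f).1 hf

lemma deflation.exists_isShortExact {Y Z : C} {g : Y ⟶ Z} (hg : E.deflation g) :
    ∃ (X : C) (f : X ⟶ Y), E.IsShortExact f g :=
  (E.deflation_iff g).1 hg

namespace IsShortExact

variable {X Y Z : C} {f : X ⟶ Y} {g : Y ⟶ Z}

lemma op (h : E.IsShortExact f g) : E.op.IsShortExact g.op f.op :=
  ⟨by rw [← op_comp, h.1, op_zero], h.2⟩

lemma unop {X Y Z : Cᵒᵖ} {f : X ⟶ Y} {g : Y ⟶ Z} (h : E.op.IsShortExact f g) :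
    E.IsShortExact g.unop f.unop :=
  ⟨by rw [← unop_comp, h.1, unop_zero], h.2⟩

lemma zero (h : E.IsShortExact f g) : f ≫ g = 0 := h.1

lemma zero_assoc (h : E.IsShortExact f g) {T : C} (t : Z ⟶ T) : f ≫ g ≫ t = 0 := by
  rw [← Category.assoc, h.zero, zero_comp]

lemma inflation (h : E.IsShortExact f g) : E.inflation f := (E.inflation_iff f).2 ⟨_, g, h⟩

lemma deflation (h : E.IsShortExact f g) : E.deflation g := (E.deflation_iff g).2 ⟨_, f, h⟩

lemma mono (h : E.IsShortExact f g) : Mono f :=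
  Fork.IsLimit.mono (E.isKernel h.2).some

lemma epi (h : E.IsShortExact f g) : Epi g :=
  Cofork.IsColimit.epi (E.isCokernel h.2).some

lemma exists_lift (h : E.IsShortExact f g) {T : C} (t : T ⟶ Y) (ht : t ≫ g = 0) :
    ∃ s : T ⟶ X, s ≫ f = t :=
  ⟨_, (KernelFork.IsLimit.lift' (E.isKernel h.2).some t ht).2⟩

lemma exists_desc (h : E.IsShortExact f g) {T : C} (t : Y ⟶ T) (ht : f ≫ t = 0) :
    ∃ s : Z ⟶ T, g ≫ s = t :=
  ⟨_, (CokernelCofork.IsColimit.desc' (E.isCokernel h.2).some t ht).2⟩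

end IsShortExact

lemma deflation_of_isIso {X Y : C} (e : X ⟶ Y) [IsIso e] : E.deflation e := by
  obtain ⟨K, f, h⟩ := (E.id_deflation X).exists_isShortExact
  exact IsShortExact.deflation (f := f) ⟨by simpa using h.zero, E.conflation_of_iso
    (ShortComplex.isoMk (S₁ := ShortComplex.mk f (𝟙 X) h.zero)
      (Iso.refl _) (Iso.refl _) (asIso e) (by simp) (by simp)) h.2⟩

lemma deflation_of_isPullback {Y Z Z' Y' : C} {p : Y ⟶ Z} {f : Z' ⟶ Z} {f' : Y' ⟶ Y}
    {p' : Y' ⟶ Z'} (h : IsPullback f' p' p f) (hp : E.deflation p) : E.deflation p' := by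
  obtain ⟨Y'', f'', p'', h', hp'⟩ := E.pullback_deflation p f hp
  rw [← h.isoIsPullback_hom_snd _ _ h']
  exact E.comp_deflation _ _ (deflation_of_isIso _) hp'

lemma deflation_snd {X Y : C} {b : BinaryBicone X Y} (hb : b.IsBilimit) : E.deflation b.snd := by
  obtain ⟨Z, g, h⟩ := (E.id_inflation X).exists_isShortExact
  have hZ : IsZero Z := by
    have := h.epi
    have hg : g = 0 := by simpa using h.zero
    exact (IsZero.iff_id_eq_zero Z).2 ((cancel_epi g).1 (by simp [hg]))
  have hp : E.deflation (hZ.isTerminal.from X) :=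
    hZ.eq_of_tgt g (hZ.isTerminal.from X) ▸ h.deflation
  exact deflation_of_isPullback (IsPullback.of_is_product hb.isLimit hZ.isTerminal) hp

/-- The graph trick: `b.fst ≫ g + b.snd ≫ p` is the pullback of `p` along
`(-g, 1) : N ⊞ X ⟶ X`, followed by the projection to `X`. -/
lemma deflation_fst_comp_add_snd_comp [HasBinaryBiproducts C] {N P X : C} {b : BinaryBicone N P}
    (hb : b.IsBilimit) (g : N ⟶ X) {p : P ⟶ X} (hp : E.deflation p) :
    E.deflation (b.fst ≫ g + b.snd ≫ p) := by
  have sq : IsPullback b.snd (biprod.lift b.fst (b.fst ≫ g + b.snd ≫ p)) p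
      (biprod.desc (-g) (𝟙 X)) :=
    ⟨⟨by simp⟩, ⟨PullbackCone.IsLimit.mk _
      (fun s => (s.snd ≫ biprod.fst) ≫ b.inl + s.fst ≫ b.inr)
      (fun s => by simp)
      (fun s => by
        have hs : s.fst ≫ p = s.snd ≫ biprod.fst ≫ (-g) + s.snd ≫ biprod.snd := by
          simpa [biprod.desc_eq] using s.condition
        ext <;> simp [hs])
      (fun s m h₁ h₂ => by
        rw [← h₁, ← h₂]
        simp [← Preadditive.comp_add, IsBilimit.binary_total hb])⟩⟩
  rw [← biprod.lift_snd b.fst (b.fst ≫ g + b.snd ≫ p)]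
  exact E.comp_deflation _ _ (deflation_of_isPullback sq hp)
    (deflation_snd (BinaryBiproduct.isBilimit N X))

/-- With `k` a kernel of `i ≫ r`, the cokernel of the inflation `k ≫ i` is the biproduct of the
cokernel of `i` and `X`, so that `r` is the composition of two deflations. -/
lemma deflation_of_inflation_comp {P N X : C} {i : P ⟶ N} (hi : E.inflation i) {r : N ⟶ X}
    (hr : E.deflation (i ≫ r)) : E.deflation r := by
  obtain ⟨K, k, hk⟩ := hr.exists_isShortExact
  obtain ⟨Q, q, hq⟩ := hi.exists_isShortExact
  obtain ⟨W, c, hc⟩ := (E.comp_inflation k i hk.inflation hi).exists_isShortExact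
  have := hk.epi
  have := hq.epi
  have := hc.epi
  obtain ⟨s, hs⟩ := hc.exists_desc r (by rw [Category.assoc, hk.zero])
  obtain ⟨q', hq'⟩ := hc.exists_desc q (by rw [Category.assoc, hq.zero, comp_zero])
  obtain ⟨t, ht⟩ := hk.exists_desc (i ≫ c) (by rw [← Category.assoc, hc.zero])
  have hts : t ≫ s = 𝟙 X := by
    rw [← cancel_epi (i ≫ r), ← Category.assoc, ht, Category.assoc, hs,
      Category.comp_id]
  have htq' : t ≫ q' = 0 := by
    rw [← cancel_epi (i ≫ r), ← Category.assoc, ht, Category.assoc, hq',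
      hq.zero, comp_zero]
  obtain ⟨u, hu⟩ := hq.exists_desc (c - r ≫ t) (by
    rw [Preadditive.comp_sub, ← ht, Category.assoc, sub_self])
  have hus : u ≫ s = 0 := by
    rw [← cancel_epi q, ← Category.assoc, hu]
    simp [hs, hts]
  have huq' : u ≫ q' = 𝟙 Q := by
    rw [← cancel_epi q, ← Category.assoc, hu]
    simp [hq', htq']
  let b : BinaryBicone Q X :=
    { pt := W, fst := q', snd := s, inl := u, inr := t, inl_fst := huq', inl_snd := hus,
      inr_fst := htq', inr_snd := hts }
  have hb : b.fst ≫ b.inl + b.snd ≫ b.inr = 𝟙 W := by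
    change q' ≫ u + s ≫ t = 𝟙 W
    rw [← cancel_epi c, Preadditive.comp_add, ← Category.assoc, hq', ← Category.assoc, hs, hu]
    simp
  rw [← hs]
  exact E.comp_deflation _ _ hc.deflation (deflation_snd (isBinaryBilimitOfTotal b hb))

namespace LeftSequence

/-- The exact sequence of a single conflation. -/
def single {K N X : C} {κ : K ⟶ N} {p : N ⟶ X} (h : E.IsShortExact κ p) :
    E.LeftSequence 0 X where
  N _ := N
  K _ := K
  ε := p
  d _ := 0
  ι _ := κ
  π _ := 0
  fac _ hi := absurd hi (Nat.not_lt_zero _)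
  exact_zero := h
  exact_succ _ hi := absurd hi (Nat.not_lt_zero _)

/-- The splice of a conflation `K ⟶ N ⟶ X` with an exact sequence ending in `K`. -/
def cons {k : ℕ} {K N X : C} {κ : K ⟶ N} {p : N ⟶ X} (h : E.IsShortExact κ p)
    (S : E.LeftSequence k K) : E.LeftSequence (k + 1) X where
  N
    | 0 => N
    | i + 1 => S.N i
  K
    | 0 => K
    | i + 1 => S.K i
  ε := p
  d
    | 0 => S.ε ≫ κ
    | i + 1 => S.d i
  ι
    | 0 => κ
    | i + 1 => S.ι i
  π
    | 0 => S.ε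
    | i + 1 => S.π i
  fac
    | 0, _ => rfl
    | i + 1, hi => S.fac i (by lia)
  exact_zero := h
  exact_succ
    | 0, _ => S.exact_zero
    | i + 1, hi => S.exact_succ i (by lia)

lemma HomExact.cons {k : ℕ} {K N X : C} {κ : K ⟶ N} {p : N ⟶ X} (h : E.IsShortExact κ p)
    {S : E.LeftSequence k K} {T : C} (hT : ∀ f : T ⟶ X, ∃ g : T ⟶ N, g ≫ p = f)
    (hS : S.HomExact T) : (S.cons h).HomExact T where
  surjective := hT
  exact_zero _ g := by
    refine ⟨fun hg => ?_, ?_⟩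
    · obtain ⟨s, rfl⟩ := h.exists_lift g hg
      obtain ⟨t, rfl⟩ := hS.surjective s
      exact ⟨t, (Category.assoc _ _ _).symm⟩
    · rintro ⟨t : T ⟶ S.N 0, rfl⟩
      change (t ≫ S.ε ≫ κ) ≫ p = 0
      simp only [Category.assoc, h.zero, comp_zero]
  exact_succ
    | 0, hi => fun (g : T ⟶ S.N 0) => by
      have := h.mono
      refine Iff.trans ?_ (hS.exact_zero (by lia) g)
      change g ≫ S.ε ≫ κ = 0 ↔ g ≫ S.ε = 0
      rw [← Category.assoc]
      exact ⟨fun h => zero_of_comp_mono _ h, fun h => by rw [h, zero_comp]⟩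
    | i + 1, hi => hS.exact_succ i (by lia)

/-- An exact sequence viewed in the opposite category. -/
def op {k : ℕ} {X : C} (S : E.LeftSequence k X) : E.op.RightSequence k (Opposite.op X) where
  N i := Opposite.op (S.N i)
  K i := Opposite.op (S.K i)
  η := S.ε.op
  d i := (S.d i).op
  π i := (S.ι i).op
  ι i := (S.π i).op
  fac i hi := Quiver.Hom.unop_inj (S.fac i hi)
  exact_zero := S.exact_zero.op
  exact_succ i hi := (S.exact_succ i hi).op

/-- An exact sequence in the opposite category viewed in the original category. -/
def unop {k : ℕ} {X : Cᵒᵖ} (S : E.op.LeftSequence k X) : E.RightSequence k X.unop where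
  N i := (S.N i).unop
  K i := (S.K i).unop
  η := S.ε.unop
  d i := (S.d i).unop
  π i := (S.ι i).unop
  ι i := (S.π i).unop
  fac i hi := Quiver.Hom.op_inj (S.fac i hi)
  exact_zero := S.exact_zero.unop
  exact_succ i hi := (S.exact_succ i hi).unop

lemma HomExact.op {k : ℕ} {X : C} {S : E.LeftSequence k X} {T : Cᵒᵖ} (hS : S.HomExact T.unop) :
    S.op.HomExact T where
  surjective f := by
    obtain ⟨g, hg⟩ := hS.surjective f.unop
    exact ⟨g.op, Quiver.Hom.unop_inj hg⟩
  exact_zero hk := exact_op_comp (hS.exact_zero hk)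
  exact_succ i hi := exact_op_comp (hS.exact_succ i hi)

lemma HomExact.unop {k : ℕ} {X : Cᵒᵖ} {S : E.op.LeftSequence k X} {T : C}
    (hS : S.HomExact (Opposite.op T)) : S.unop.HomExact T where
  surjective f := by
    obtain ⟨g, hg⟩ := hS.surjective f.op
    exact ⟨g.unop, Quiver.Hom.op_inj hg⟩
  exact_zero hk := exact_unop_comp (hS.exact_zero hk)
  exact_succ i hi := exact_unop_comp (hS.exact_succ i hi)

end LeftSequence

namespace RightSequence

/-- The exact sequence obtained by omitting the last terms. -/
def truncate {m n : ℕ} (hmn : m ≤ n) {X : C} (S : E.RightSequence n X) : E.RightSequence m X where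
  __ := S
  fac i hi := S.fac i (hi.trans_le hmn)
  exact_succ i hi := S.exact_succ i (hi.trans_le hmn)

lemma HomExact.truncate {m n : ℕ} (hmn : m ≤ n) {X T : C} {S : E.RightSequence n X}
    (hS : S.HomExact T) : (S.truncate hmn).HomExact T where
  surjective := hS.surjective
  exact_zero hm := hS.exact_zero (hm.trans_le hmn)
  exact_succ i hi := hS.exact_succ i (hi.trans_le hmn)

/-- The part of an exact sequence starting in the first cokernel. -/
def tail {k : ℕ} {X : C} (S : E.RightSequence (k + 1) X) : E.RightSequence k (S.K 0) where
  N i := S.N (i + 1)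
  K i := S.K (i + 1)
  η := S.ι 0
  d i := S.d (i + 1)
  ι i := S.ι (i + 1)
  π i := S.π (i + 1)
  fac i hi := S.fac (i + 1) (by lia)
  exact_zero := S.exact_succ 0 (by lia)
  exact_succ i hi := S.exact_succ (i + 1) (by lia)

lemma HomExact.tail {k : ℕ} {X : C} {S : E.RightSequence (k + 1) X} {T : C}
    (hS : S.HomExact T) : S.tail.HomExact T where
  surjective (g : S.K 0 ⟶ T) := by
    have := S.exact_zero.epi
    obtain ⟨t, ht⟩ := (hS.exact_zero (by lia) (S.π 0 ≫ g)).1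
      (S.exact_zero.zero_assoc _)
    refine ⟨t, (cancel_epi (S.π 0)).1 ?_⟩
    simp only [← ht, ← S.fac 0 (by lia), Category.assoc, RightSequence.tail]
  exact_zero hk (g : S.N 1 ⟶ T) := by
    have := S.exact_zero.epi
    refine Iff.trans ?_ (hS.exact_succ 0 (by lia) g)
    change S.ι 0 ≫ g = 0 ↔ S.d 0 ≫ g = 0
    rw [← S.fac 0 (by lia), Category.assoc]
    exact ⟨fun h => by rw [h, comp_zero], fun h => zero_of_epi_comp _ h⟩
  exact_succ i hi := hS.exact_succ (i + 1) (by lia)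

end RightSequence

variable {M : ObjectProperty C} {k : ℕ}

lemma gen.op {X : C} (h : E.gen M k X) : E.op.cogen M.op k (Opposite.op X) := by
  obtain ⟨S, hN, hS⟩ := h
  exact ⟨S.op, hN, fun T hT => (hS T.unop hT).op⟩

lemma gen.unop {X : Cᵒᵖ} (h : E.op.gen M.op k X) : E.cogen M k X.unop := by
  obtain ⟨S, hN, hS⟩ := h
  exact ⟨S.unop, hN, fun T hT => (hS (Opposite.op T) hT).unop⟩

lemma cogen_antitone (E : ExactStructure C) (M : ObjectProperty C) : Antitone (E.cogen M) := by
  rintro m n hmn X ⟨S, hN, hS⟩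
  exact ⟨S.truncate hmn, fun i hi => hN i (hi.trans hmn), fun T hT => (hS T hT).truncate hmn⟩

/-- `K ⟶ N ⟶ X` is a conflation with `N` in `M` whose deflation is a right `M`-approximation. -/
structure IsRightApprox (E : ExactStructure C) (M : ObjectProperty C) {K N X : C}
    (κ : K ⟶ N) (p : N ⟶ X) : Prop where
  mem : M N
  exact : E.IsShortExact κ p
  lift : ∀ T, M T → ∀ f : T ⟶ X, ∃ g : T ⟶ N, g ≫ p = f

/-- `X ⟶ N ⟶ K` is a conflation with `N` in `M` whose inflation is a left `M`-approximation. -/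
structure IsLeftApprox (E : ExactStructure C) (M : ObjectProperty C) {X N K : C}
    (i : X ⟶ N) (q : N ⟶ K) : Prop where
  mem : M N
  exact : E.IsShortExact i q
  extend : ∀ T, M T → ∀ f : X ⟶ T, ∃ g : N ⟶ T, i ≫ g = f

lemma IsRightApprox.gen_zero {K N X : C} {κ : K ⟶ N} {p : N ⟶ X} (h : E.IsRightApprox M κ p) :
    E.gen M 0 X :=
  ⟨.single h.exact, fun _ _ => h.mem, fun T hT =>
    { surjective := h.lift T hT
      exact_zero h₀ := absurd h₀ (lt_irrefl 0)
      exact_succ _ hi := absurd hi (Nat.not_lt_zero _) }⟩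

lemma IsRightApprox.gen_succ {K N X : C} {κ : K ⟶ N} {p : N ⟶ X} (h : E.IsRightApprox M κ p)
    (hK : E.gen M k K) : E.gen M (k + 1) X := by
  obtain ⟨S, hN, hS⟩ := hK
  refine ⟨S.cons h.exact, ?_, fun T hT => (hS T hT).cons h.exact (h.lift T hT)⟩
  rintro (_ | i) hi
  · exact h.mem
  · exact hN i (by lia)

lemma cogen.exists_isLeftApprox {X : C} (h : E.cogen M k X) :
    ∃ (N K : C) (i : X ⟶ N) (q : N ⟶ K), E.IsLeftApprox M i q := by
  obtain ⟨S, hN, hS⟩ := h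
  exact ⟨_, _, _, _, hN 0 (Nat.zero_le k), S.exact_zero, fun T hT => (hS T hT).surjective⟩

lemma cogen.exists_isLeftApprox_of_succ {X : C} (h : E.cogen M (k + 1) X) :
    ∃ (N K : C) (i : X ⟶ N) (q : N ⟶ K), E.IsLeftApprox M i q ∧ E.cogen M k K := by
  obtain ⟨S, hN, hS⟩ := h
  exact ⟨_, _, _, _, ⟨hN 0 (by lia), S.exact_zero, fun T hT => (hS T hT).surjective⟩,
    S.tail, fun i hi => hN (i + 1) (by lia), fun T hT => (hS T hT).tail⟩

/-- Every morphism to `X` from an object of `cogen^n(M)` factors through an object of `M`. This is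
the property of the injectives that passes to the kernels of right `M`-approximations. -/
def FactorsThrough (E : ExactStructure C) (M : ObjectProperty C) (n : ℕ) (X : C) : Prop :=
  ∀ L, E.cogen M n L → ∀ f : L ⟶ X, ∃ (N : C) (a : L ⟶ N) (b : N ⟶ X), M N ∧ a ≫ b = f

lemma injectives.factorsThrough {I : C} (hI : E.injectives I) (n : ℕ) :
    E.FactorsThrough M n I := by
  intro L hL f
  obtain ⟨N, K, i, q, h⟩ := hL.exists_isLeftApprox
  obtain ⟨g, hg⟩ := hI i h.exact.inflation f
  exact ⟨N, i, g, h.mem, hg⟩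

lemma FactorsThrough.succ {n : ℕ} {K N X : C} {κ : K ⟶ N} {p : N ⟶ X}
    (hX : E.FactorsThrough M n X) (h : E.IsRightApprox M κ p) :
    E.FactorsThrough M (n + 1) K := by
  intro L hL f
  obtain ⟨N₀, L', i, q, hi, hL'⟩ := hL.exists_isLeftApprox_of_succ
  have := h.exact.mono
  obtain ⟨g, hg⟩ := hi.extend N h.mem (f ≫ κ)
  obtain ⟨t, ht⟩ := hi.exact.exists_desc (g ≫ p) (by
    rw [← Category.assoc, hg, Category.assoc, h.exact.zero, comp_zero])
  obtain ⟨N₁, a, b, hN₁, rfl⟩ := hX L' hL' t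
  obtain ⟨b', rfl⟩ := h.lift N₁ hN₁ b
  obtain ⟨s, hs⟩ := h.exact.exists_lift (g - q ≫ a ≫ b') (by
    simp only [Preadditive.sub_comp, Category.assoc, ht, sub_self])
  refine ⟨N₀, i, s, hi.mem, (cancel_mono κ).1 ?_⟩
  rw [Category.assoc, hs, Preadditive.comp_sub, hg, hi.exact.zero_assoc, sub_zero]

/-- Factor a deflation `P ⟶ X` from a projective as `P ⟶ N₀ ⟶ N ⟶ X`, the first morphism being an
inflation and a left approximation. Then `N₀ ⟶ X` is a deflation, hence so is `N ⊞ N₀ ⟶ X`. -/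
lemma exists_isRightApprox [HasBinaryBiproducts C] (hP : E.EnoughProjectives)
    (hM : ∀ N N', M N → M N' → ∃ b : BinaryBicone N N', Nonempty b.IsBilimit ∧ M b.pt)
    (hcogen : E.projectives ≤ E.cogen M k) {X : C} (hX : E.FactorsThrough M k X)
    {N : C} (hN : M N) (g : N ⟶ X) (hg : ∀ T, M T → ∀ f : T ⟶ X, ∃ h : T ⟶ N, h ≫ g = f) :
    ∃ (K N' : C) (κ : K ⟶ N') (p : N' ⟶ X), E.IsRightApprox M κ p := by
  obtain ⟨P, p, hPproj, hp⟩ := hP X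
  obtain ⟨N₀, L, i, q, hi⟩ := (hcogen P hPproj).exists_isLeftApprox
  obtain ⟨N₁, a, b, hN₁, rfl⟩ := hX P (hcogen P hPproj) p
  obtain ⟨a, rfl⟩ := hi.extend N₁ hN₁ a
  have hab : E.deflation (a ≫ b) :=
    deflation_of_inflation_comp hi.exact.inflation (by rwa [← Category.assoc])
  obtain ⟨B, ⟨hB⟩, hMB⟩ := hM N N₀ hN hi.mem
  obtain ⟨K, κ, hκ⟩ := (deflation_fst_comp_add_snd_comp hB g hab).exists_isShortExact
  refine ⟨K, B.pt, κ, _, hMB, hκ, fun T hT f => ?_⟩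
  obtain ⟨h, rfl⟩ := hg T hT f
  exact ⟨h ≫ B.inl, by simp⟩

end ExactStructure

end ExactCategories

section Modules

variable {A : Type u} [Category.{v} A] [Preadditive A]

instance (J : Type) [SmallCategory J] :
    (additiveFunctor A AddCommGrpCat.{v}).IsClosedUnderColimitsOfShape J where
  colimitsOfShape_le := by
    rintro F ⟨h⟩
    refine ⟨fun {a b f g} => ?_⟩
    refine (isColimitOfPreserves ((evaluation A AddCommGrpCat.{v}).obj a) h.isColimit).hom_ext
      fun j => ?_
    have : (h.diag.obj j).Additive := h.prop_diag_obj j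
    have hj : ∀ φ : a ⟶ b, (h.diag.obj j).map φ ≫ (h.ι.app j).app b =
      (h.ι.app j).app a ≫ F.map φ := fun φ => (h.ι.app j).naturality φ
    change (h.ι.app j).app a ≫ F.map (f + g) = (h.ι.app j).app a ≫ (F.map f + F.map g)
    rw [Preadditive.comp_add, ← hj, ← hj, ← hj, Functor.map_add, Preadditive.add_comp]

instance : HasBinaryBiproducts (A ⥤+ AddCommGrpCat.{v}) :=
  HasBinaryBiproducts.of_hasBinaryCoproducts

lemma epi_iff_surjective {F G : A ⥤+ AddCommGrpCat.{v}} (e : F ⟶ G) :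
    Epi e ↔ ∀ a, Function.Surjective (e.hom.app a) := by
  simp only [← AddCommGrpCat.epi_iff_surjective, ← NatTrans.epi_iff_epi_app]
  exact ((additiveFunctor A AddCommGrpCat.{v}).ι.epi_map_iff_epi e).symm

lemma naturality_apply {F G : A ⥤+ AddCommGrpCat.{v}} (φ : F ⟶ G) {a b : A} (f : a ⟶ b)
    (x : F.obj.obj a) : φ.hom.app b (F.obj.map f x) = G.obj.map f (φ.hom.app a x) :=
  NatTrans.naturality_apply φ.hom f x

lemma map_add_apply (F : A ⥤+ AddCommGrpCat.{v}) {a b : A} (f g : a ⟶ b) (x : F.obj.obj a) :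
    F.obj.map (f + g) x = F.obj.map f x + F.obj.map g x := by
  rw [Functor.map_add]
  rfl

lemma map_comp_apply (F : A ⥤+ AddCommGrpCat.{v}) {a b c : A} (f : a ⟶ b) (g : b ⟶ c)
    (x : F.obj.obj a) : F.obj.map (f ≫ g) x = F.obj.map g (F.obj.map f x) := by
  rw [Functor.map_comp]
  rfl

lemma congr_app_apply {F G : A ⥤+ AddCommGrpCat.{v}} {φ ψ : F ⟶ G} (h : φ = ψ) {a : A}
    (x : F.obj.obj a) : φ.hom.app a x = ψ.hom.app a x := by
  rw [h]

lemma biprod_total_apply {F G : A ⥤+ AddCommGrpCat.{v}} {a : A} (z : (F ⊞ G).obj.obj a) :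
    (biprod.inl : F ⟶ F ⊞ G).hom.app a ((biprod.fst : F ⊞ G ⟶ F).hom.app a z) +
      (biprod.inr : G ⟶ F ⊞ G).hom.app a ((biprod.snd : F ⊞ G ⟶ G).hom.app a z) = z :=
  congr_app_apply biprod.total z

lemma biprod_ext_apply {F G : A ⥤+ AddCommGrpCat.{v}} {a : A} {z w : (F ⊞ G).obj.obj a}
    (h₁ : (biprod.fst : F ⊞ G ⟶ F).hom.app a z = (biprod.fst : F ⊞ G ⟶ F).hom.app a w)
    (h₂ : (biprod.snd : F ⊞ G ⟶ G).hom.app a z = (biprod.snd : F ⊞ G ⟶ G).hom.app a w) :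
    z = w := by
  rw [← biprod_total_apply z, h₁, h₂, biprod_total_apply]

lemma exists_biprod_apply {F G : A ⥤+ AddCommGrpCat.{v}} {a : A} (x : F.obj.obj a)
    (y : G.obj.obj a) : ∃ z, (biprod.fst : F ⊞ G ⟶ F).hom.app a z = x ∧
      (biprod.snd : F ⊞ G ⟶ G).hom.app a z = y := by
  refine ⟨(biprod.inl : F ⟶ F ⊞ G).hom.app a x + (biprod.inr : G ⟶ F ⊞ G).hom.app a y, ?_, ?_⟩
  · rw [map_add]
    exact (congrArg₂ (· + ·) (congr_app_apply biprod.inl_fst x)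
      (congr_app_apply biprod.inr_fst y)).trans (add_zero x)
  · rw [map_add]
    exact (congrArg₂ (· + ·) (congr_app_apply biprod.inl_snd x)
      (congr_app_apply biprod.inr_snd y)).trans (zero_add y)

lemma biprod_fst_inl_apply {F G : A ⥤+ AddCommGrpCat.{v}} {a : A} (x : F.obj.obj a) :
    (biprod.fst : F ⊞ G ⟶ F).hom.app a ((biprod.inl : F ⟶ F ⊞ G).hom.app a x) = x :=
  congr_app_apply biprod.inl_fst x

lemma biprod_snd_inl_apply {F G : A ⥤+ AddCommGrpCat.{v}} {a : A} (x : F.obj.obj a) :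
    (biprod.snd : F ⊞ G ⟶ G).hom.app a ((biprod.inl : F ⟶ F ⊞ G).hom.app a x) = 0 :=
  congr_app_apply biprod.inl_snd x

lemma biprod_fst_lift_apply {F G H : A ⥤+ AddCommGrpCat.{v}} (φ : H ⟶ F) (ψ : H ⟶ G) {a : A}
    (x : H.obj.obj a) :
    (biprod.fst : F ⊞ G ⟶ F).hom.app a ((biprod.lift φ ψ).hom.app a x) = φ.hom.app a x :=
  congr_app_apply (biprod.lift_fst φ ψ) x

lemma biprod_snd_lift_apply {F G H : A ⥤+ AddCommGrpCat.{v}} (φ : H ⟶ F) (ψ : H ⟶ G) {a : A}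
    (x : H.obj.obj a) :
    (biprod.snd : F ⊞ G ⟶ G).hom.app a ((biprod.lift φ ψ).hom.app a x) = ψ.hom.app a x :=
  congr_app_apply (biprod.lift_snd φ ψ) x

lemma biprod_desc_apply {F G H : A ⥤+ AddCommGrpCat.{v}} (φ : F ⟶ H) (ψ : G ⟶ H) {a : A}
    (z : (F ⊞ G).obj.obj a) :
    (biprod.desc φ ψ).hom.app a z =
      φ.hom.app a ((biprod.fst : F ⊞ G ⟶ F).hom.app a z) +
        ψ.hom.app a ((biprod.snd : F ⊞ G ⟶ G).hom.app a z) :=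
  congr_app_apply biprod.desc_eq z

lemma exists_biprod_inl_eq_iff {F G : A ⥤+ AddCommGrpCat.{v}} {a : A} (z : (F ⊞ G).obj.obj a) :
    (∃ x, (biprod.inl : F ⟶ F ⊞ G).hom.app a x = z) ↔
      (biprod.snd : F ⊞ G ⟶ G).hom.app a z = 0 := by
  refine ⟨?_, fun h => ⟨(biprod.fst : F ⊞ G ⟶ F).hom.app a z, ?_⟩⟩
  · rintro ⟨x, rfl⟩
    exact biprod_snd_inl_apply x
  · exact biprod_ext_apply (biprod_fst_inl_apply _) ((biprod_snd_inl_apply _).trans h.symm)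

lemma injective_biprod_inl {F G : A ⥤+ AddCommGrpCat.{v}} (a : A) :
    Function.Injective ((biprod.inl : F ⟶ F ⊞ G).hom.app a) :=
  Function.LeftInverse.injective (g := (biprod.fst : F ⊞ G ⟶ F).hom.app a) biprod_fst_inl_apply

/-- The left `A`-module `Hom(a, -)`. -/
def coyonedaModule (a : A) : A ⥤+ AddCommGrpCat.{v} :=
  AdditiveFunctor.of (preadditiveCoyoneda.obj (Opposite.op a))

/-- The morphism of Yoneda's lemma attached to an element of a module. -/
def coyonedaDesc {F : A ⥤+ AddCommGrpCat.{v}} {a : A} (x : F.obj.obj a) : coyonedaModule a ⟶ F where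
  hom :=
    { app b := AddCommGrpCat.ofHom
        (AddMonoidHom.mk' (fun f : a ⟶ b => F.obj.map f x) fun f g => map_add_apply F f g x)
      naturality b c g := by
        ext f
        exact map_comp_apply F f g x }

lemma isFinGen_coyonedaModule (a : A) : IsFinGen (coyonedaModule a) :=
  ⟨1, fun _ => a, fun _ => 𝟙 a, fun _ f =>
    ⟨fun _ => f, ((Fin.sum_univ_one _).trans (Category.id_comp (X := a) f)).symm⟩⟩

instance projective_coyonedaModule (a : A) : Projective (coyonedaModule a) where
  factors {G H} f e he := by
    obtain ⟨y, hy⟩ := (epi_iff_surjective e).1 he a (f.hom.app a (𝟙 a))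
    refine ⟨coyonedaDesc y, ?_⟩
    ext b (g : a ⟶ b)
    calc e.hom.app b (G.obj.map g y) = H.obj.map g (f.hom.app a (𝟙 a)) := by
          rw [naturality_apply, hy]
      _ = f.hom.app b (𝟙 a ≫ g) := (naturality_apply f g (𝟙 a)).symm
      _ = f.hom.app b g := congrArg (f.hom.app b) (Category.id_comp g)

namespace IsFinGen

lemma of_fintype {F : A ⥤+ AddCommGrpCat.{v}} {ι : Type*} [Fintype ι] (a : ι → A)
    (x : ∀ i, F.obj.obj (a i))
    (h : ∀ (b : A) (y : F.obj.obj b), ∃ f : ∀ i, a i ⟶ b, y = ∑ i, F.obj.map (f i) (x i)) :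
    IsFinGen F := by
  let e := (Fintype.equivFin ι).symm
  refine ⟨Fintype.card ι, a ∘ e, fun i => x (e i), fun b y => ?_⟩
  obtain ⟨f, rfl⟩ := h b y
  exact ⟨fun i => f (e i), (e.sum_comp fun i => F.obj.map (f i) (x i)).symm⟩

variable {F G : A ⥤+ AddCommGrpCat.{v}}

lemma of_surjective (h : IsFinGen F) (e : F ⟶ G)
    (he : ∀ a, Function.Surjective (e.hom.app a)) : IsFinGen G := by
  obtain ⟨n, a, x, hx⟩ := h
  refine ⟨n, a, fun i => e.hom.app _ (x i), fun b y => ?_⟩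
  obtain ⟨z, rfl⟩ := he b y
  obtain ⟨f, rfl⟩ := hx b z
  exact ⟨f, by simp only [map_sum, naturality_apply]⟩

lemma of_iso (h : IsFinGen F) (e : F ≅ G) : IsFinGen G :=
  h.of_surjective e.hom ((epi_iff_surjective e.hom).1 inferInstance)

lemma biprod (hF : IsFinGen F) (hG : IsFinGen G) : IsFinGen (F ⊞ G) := by
  obtain ⟨m, a, x, hx⟩ := hF
  obtain ⟨n, b, y, hy⟩ := hG
  refine of_fintype (Sum.elim a b) (fun
    | .inl i => (biprod.inl : F ⟶ F ⊞ G).hom.app _ (x i)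
    | .inr j => (biprod.inr : G ⟶ F ⊞ G).hom.app _ (y j)) fun c z => ?_
  obtain ⟨f, hf⟩ := hx c ((biprod.fst : F ⊞ G ⟶ F).hom.app c z)
  obtain ⟨g, hg⟩ := hy c ((biprod.snd : F ⊞ G ⟶ G).hom.app c z)
  refine ⟨fun
    | .inl i => f i
    | .inr j => g j, ?_⟩
  rw [← biprod_total_apply z, hf, hg]
  simp only [Fintype.sum_sum_type, map_sum, naturality_apply]
  rfl

end IsFinGen

lemma exists_lift_of_exact {F K G H : A ⥤+ AddCommGrpCat.{v}} {ι : K ⟶ G} {p : G ⟶ H}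
    (hι : ∀ a, Function.Injective (ι.hom.app a))
    (hex : ∀ a, Function.Exact (ι.hom.app a) (p.hom.app a)) (φ : F ⟶ G) (hφ : φ ≫ p = 0) :
    ∃ ψ : F ⟶ K, ψ ≫ ι = φ := by
  choose s hs using fun a x => (hex a (φ.hom.app a x)).1
    (congrArg (fun θ : F ⟶ H => θ.hom.app a x) hφ)
  refine ⟨⟨{ app a := AddCommGrpCat.ofHom (AddMonoidHom.mk' (s a) fun x y => hι a ?_)
             naturality a b f := ?_ }⟩, ?_⟩
  · simp only [map_add, hs]
  · ext x
    refine hι b ?_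
    change ι.hom.app b (s b (F.obj.map f x)) = ι.hom.app b (K.obj.map f (s a x))
    rw [hs, naturality_apply, naturality_apply, hs]
  · ext a x
    exact hs a x

section Schanuel

variable {P₁ P₀ K R F : A ⥤+ AddCommGrpCat.{v}} {d : P₁ ⟶ P₀} {ε : P₀ ⟶ F} {ι : K ⟶ R}
  {p : R ⟶ F} {α : R ⟶ P₀} {β : P₀ ⟶ R} {ψ : P₁ ⊞ R ⟶ K}

lemma surjective_biprod_lift_desc (hα : α ≫ ε = p) (hβ : β ≫ p = ε)
    (hψ : ψ ≫ ι = biprod.snd - biprod.desc d α ≫ β)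
    (hdε : ∀ a, Function.Exact (d.hom.app a) (ε.hom.app a))
    (hιp : ∀ a, Function.Exact (ι.hom.app a) (p.hom.app a))
    (hι : ∀ a, Function.Injective (ι.hom.app a)) (a : A) :
    Function.Surjective ((biprod.lift ψ (biprod.desc d α)).hom.app a) := by
  intro z
  set k := (biprod.fst : K ⊞ P₀ ⟶ K).hom.app a z
  set y := (biprod.snd : K ⊞ P₀ ⟶ P₀).hom.app a z
  set r := ι.hom.app a k + β.hom.app a y with hr
  have hy : ε.hom.app a (y - α.hom.app a r) = 0 := by
    have hαr : ε.hom.app a (α.hom.app a r) = p.hom.app a r := congr_app_apply hα r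
    have hβy : p.hom.app a (β.hom.app a y) = ε.hom.app a y := congr_app_apply hβ y
    rw [map_sub, hαr, hr, map_add, (hιp a).apply_apply_eq_zero, zero_add, hβy, sub_self]
  obtain ⟨x, hx⟩ := (hdε a _).1 hy
  obtain ⟨w, hw₁, hw₂⟩ := exists_biprod_apply x r
  have hγw : (biprod.desc d α).hom.app a w = y := by
    rw [biprod_desc_apply, hw₁, hw₂, hx, sub_add_cancel]
  have hψw : ι.hom.app a (ψ.hom.app a w) =
      (biprod.snd : P₁ ⊞ R ⟶ R).hom.app a w - β.hom.app a ((biprod.desc d α).hom.app a w) :=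
    congr_app_apply hψ w
  refine ⟨w, biprod_ext_apply ?_ ?_⟩
  · rw [biprod_fst_lift_apply]
    exact hι a (by rw [hψw, hw₂, hγw, hr, add_sub_cancel_right])
  · rw [biprod_snd_lift_apply, hγw]

lemma biprod_lift_desc_apply_eq_zero_iff (hψ : ψ ≫ ι = biprod.snd - biprod.desc d α ≫ β)
    (hι : ∀ a, Function.Injective (ι.hom.app a)) {a : A} (w : (P₁ ⊞ R).obj.obj a) :
    (biprod.lift ψ (biprod.desc d α)).hom.app a w = 0 ↔
      ∃ x, d.hom.app a x = 0 ∧ (biprod.inl : P₁ ⟶ P₁ ⊞ R).hom.app a x = w := by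
  have hψ (w) : ι.hom.app a (ψ.hom.app a w) =
      (biprod.snd : P₁ ⊞ R ⟶ R).hom.app a w - β.hom.app a ((biprod.desc d α).hom.app a w) :=
    congr_app_apply hψ w
  constructor
  · intro hw
    have hψw : ψ.hom.app a w = 0 := by
      rw [← biprod_fst_lift_apply ψ (biprod.desc d α), hw, map_zero]
    have hγw : (biprod.desc d α).hom.app a w = 0 := by
      rw [← biprod_snd_lift_apply ψ (biprod.desc d α), hw, map_zero]
    have hw₂ : (biprod.snd : P₁ ⊞ R ⟶ R).hom.app a w = 0 := by
      simpa only [hψw, hγw, map_zero, sub_zero, eq_comm] using hψ w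
    obtain ⟨x, rfl⟩ := (exists_biprod_inl_eq_iff w).2 hw₂
    exact ⟨x, by rwa [biprod_desc_apply, hw₂, map_zero, add_zero, biprod_fst_inl_apply] at hγw, rfl⟩
  · rintro ⟨x, hx, rfl⟩
    have hγx : (biprod.desc d α).hom.app a ((biprod.inl : P₁ ⟶ P₁ ⊞ R).hom.app a x) = 0 := by
      rw [biprod_desc_apply, biprod_fst_inl_apply, biprod_snd_inl_apply, hx, map_zero, add_zero]
    refine biprod_ext_apply ?_ ?_
    · rw [biprod_fst_lift_apply, map_zero]
      exact hι a (by rw [hψ, hγx, biprod_snd_inl_apply, map_zero, map_zero, sub_zero])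
    · rw [biprod_snd_lift_apply, hγx, map_zero]

/-- Schanuel's lemma for the kernel `K` of `p` and a morphism `d` onto the kernel of `ε`: with lifts
`α` and `β` of `p` and `ε` along each other and `γ = (d, α)`, the morphism is
`(ι⁻¹ (snd - β γ), γ)`. -/
lemma exists_schanuel [Projective P₀] [Projective R]
    (hε : ∀ a, Function.Surjective (ε.hom.app a)) (hp : ∀ a, Function.Surjective (p.hom.app a))
    (hdε : ∀ a, Function.Exact (d.hom.app a) (ε.hom.app a))
    (hιp : ∀ a, Function.Exact (ι.hom.app a) (p.hom.app a))
    (hι : ∀ a, Function.Injective (ι.hom.app a)) :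
    ∃ φ : P₁ ⊞ R ⟶ K ⊞ P₀, (∀ a, Function.Surjective (φ.hom.app a)) ∧
      ∀ a w, φ.hom.app a w = 0 ↔
        ∃ x, d.hom.app a x = 0 ∧ (biprod.inl : P₁ ⟶ P₁ ⊞ R).hom.app a x = w := by
  have : Epi ε := (epi_iff_surjective _).2 hε
  have : Epi p := (epi_iff_surjective _).2 hp
  obtain ⟨α, hα⟩ := Projective.factors p ε
  obtain ⟨β, hβ⟩ := Projective.factors ε p
  have hdε₀ : d ≫ ε = 0 := by
    ext a x
    exact (hdε a).apply_apply_eq_zero x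
  have hγ : (biprod.snd - biprod.desc d α ≫ β) ≫ p = 0 := by
    apply biprod.hom_ext' <;> simp [hα, hβ, hdε₀]
  obtain ⟨ψ, hψ⟩ := exists_lift_of_exact hι hιp _ hγ
  exact ⟨biprod.lift ψ (biprod.desc d α), surjective_biprod_lift_desc hα hβ hψ hdε hιp hι,
    fun a w => biprod_lift_desc_apply_eq_zero_iff hψ hι w⟩

end Schanuel

lemma exact_comp_biprod_inl {Q P₁ P₀ R G : A ⥤+ AddCommGrpCat.{v}} {d₁ : Q ⟶ P₁} {d₀ : P₁ ⟶ P₀}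
    {φ : P₁ ⊞ R ⟶ G} {a : A} (hd : Function.Exact (d₁.hom.app a) (d₀.hom.app a))
    (hφ : ∀ w, φ.hom.app a w = 0 ↔
      ∃ x, d₀.hom.app a x = 0 ∧ (biprod.inl : P₁ ⟶ P₁ ⊞ R).hom.app a x = w) :
    Function.Exact ((d₁ ≫ (biprod.inl : P₁ ⟶ P₁ ⊞ R)).hom.app a) (φ.hom.app a) := by
  refine fun w => (hφ w).trans ⟨?_, ?_⟩
  · rintro ⟨x, hx, rfl⟩
    obtain ⟨y, rfl⟩ := (hd x).1 hx
    exact ⟨y, rfl⟩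
  · rintro ⟨y, rfl⟩
    exact ⟨_, hd.apply_apply_eq_zero y, rfl⟩

lemma exact_biprod_inl_comp {P₁ P₀ R G : A ⥤+ AddCommGrpCat.{v}} {d : P₁ ⟶ P₀} {φ : G ⟶ P₁} {a : A}
    (hd : Function.Exact (φ.hom.app a) (d.hom.app a)) :
    Function.Exact (φ.hom.app a) ((d ≫ (biprod.inl : P₀ ⟶ P₀ ⊞ R)).hom.app a) :=
  fun x => Iff.trans (map_eq_zero_iff ((biprod.inl : P₀ ⟶ P₀ ⊞ R).hom.app a).hom
    (injective_biprod_inl a)) (hd x)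

section SplitOff

variable {Q₁ Q₀ K P : A ⥤+ AddCommGrpCat.{v}} {d : Q₁ ⟶ Q₀} {ε : Q₀ ⟶ K ⊞ P} {s : P ⟶ Q₀} {a : A}

lemma exact_biprod_desc_comp_fst (hs : s ≫ ε = biprod.inr)
    (hdε : Function.Exact (d.hom.app a) (ε.hom.app a)) :
    Function.Exact ((biprod.desc d s).hom.app a) ((ε ≫ biprod.fst).hom.app a) := by
  have hs (y) : ε.hom.app a (s.hom.app a y) = (biprod.inr : P ⟶ K ⊞ P).hom.app a y :=
    congr_app_apply hs y
  intro x
  constructor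
  · intro (hx : (biprod.fst : K ⊞ P ⟶ K).hom.app a (ε.hom.app a x) = 0)
    set y := (biprod.snd : K ⊞ P ⟶ P).hom.app a (ε.hom.app a x)
    have hxy : ε.hom.app a (x - s.hom.app a y) = 0 := by
      rw [map_sub, hs, sub_eq_zero, ← biprod_total_apply (ε.hom.app a x), hx, map_zero, zero_add]
    obtain ⟨q, hq⟩ := (hdε _).1 hxy
    obtain ⟨w, hw₁, hw₂⟩ := exists_biprod_apply q y
    exact ⟨w, by rw [biprod_desc_apply, hw₁, hw₂, hq, sub_add_cancel]⟩
  · rintro ⟨w, rfl⟩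
    change (biprod.fst : K ⊞ P ⟶ K).hom.app a (ε.hom.app a _) = 0
    rw [biprod_desc_apply, map_add, hdε.apply_apply_eq_zero, zero_add, hs]
    exact congr_app_apply biprod.inr_fst _

lemma biprod_desc_apply_eq_zero_iff (hs : s ≫ ε = biprod.inr)
    (hdε : Function.Exact (d.hom.app a) (ε.hom.app a)) (w : (Q₁ ⊞ P).obj.obj a) :
    (biprod.desc d s).hom.app a w = 0 ↔
      ∃ x, d.hom.app a x = 0 ∧ (biprod.inl : Q₁ ⟶ Q₁ ⊞ P).hom.app a x = w := by
  have hs (y) : (biprod.snd : K ⊞ P ⟶ P).hom.app a (ε.hom.app a (s.hom.app a y)) = y :=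
    (congrArg _ (congr_app_apply hs y)).trans (congr_app_apply biprod.inr_snd y)
  rw [biprod_desc_apply]
  constructor
  · intro hw
    have hw₂ : (biprod.snd : Q₁ ⊞ P ⟶ P).hom.app a w = 0 := by
      have hεw := congrArg (ε.hom.app a) hw
      rw [map_add, hdε.apply_apply_eq_zero, zero_add, map_zero] at hεw
      rw [← hs ((biprod.snd : Q₁ ⊞ P ⟶ P).hom.app a w), hεw, map_zero]
    obtain ⟨x, rfl⟩ := (exists_biprod_inl_eq_iff w).2 hw₂
    exact ⟨x, by rwa [hw₂, map_zero, add_zero, biprod_fst_inl_apply] at hw, rfl⟩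
  · rintro ⟨x, hx, rfl⟩
    rw [biprod_fst_inl_apply, biprod_snd_inl_apply, hx, map_zero, add_zero]

end SplitOff

namespace modK

variable {n : ℕ} {F K R : A ⥤+ AddCommGrpCat.{v}}

lemma isFinGen (h : modK A n F) : IsFinGen F := by
  obtain ⟨S⟩ := h
  exact (S.finGen 0 (Nat.zero_le n)).of_surjective S.ε S.surjective

lemma kernel_biprod (S : ModulePresentation (n + 1) F) {ι : K ⟶ R} {p : R ⟶ F}
    (hR : IsFinGen R) [Projective R] (hp : ∀ a, Function.Surjective (p.hom.app a))
    (hιp : ∀ a, Function.Exact (ι.hom.app a) (p.hom.app a))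
    (hι : ∀ a, Function.Injective (ι.hom.app a)) : modK A n (K ⊞ S.P 0) := by
  have : Projective (S.P 0) := S.projective 0 (by lia)
  have : Projective (S.P 1) := S.projective 1 (by lia)
  obtain ⟨φ, hφ, hφ₀⟩ := exists_schanuel S.surjective hp (S.exact_zero (by lia)) hιp hι
  exact ⟨{
    P
      | 0 => S.P 1 ⊞ R
      | i + 1 => S.P (i + 2)
    ε := φ
    d
      | 0 => S.d 1 ≫ biprod.inl
      | i + 1 => S.d (i + 2)
    finGen
      | 0, _ => (S.finGen 1 (by lia)).biprod hR
      | i + 1, hi => S.finGen (i + 2) (by lia)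
    projective
      | 0, _ => inferInstance
      | i + 1, hi => S.projective (i + 2) (by lia)
    surjective := hφ
    exact_zero hn a := exact_comp_biprod_inl (S.exact_succ 0 (by lia) a) (hφ₀ a)
    exact_succ
      | 0, hi => fun a => exact_biprod_inl_comp (S.exact_succ 1 (by lia) a)
      | i + 1, hi => S.exact_succ (i + 2) (by lia) }⟩

lemma of_biprod {P : A ⥤+ AddCommGrpCat.{v}} (h : modK A n (K ⊞ P)) (hP : IsFinGen P)
    [Projective P] : modK A n K := by
  obtain ⟨S⟩ := h
  have : Epi S.ε := (epi_iff_surjective _).2 S.surjective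
  obtain ⟨s, hs⟩ := Projective.factors biprod.inr S.ε
  exact ⟨{
    P
      | 0 => S.P 0
      | 1 => S.P 1 ⊞ P
      | i + 2 => S.P (i + 2)
    ε := S.ε ≫ biprod.fst
    d
      | 0 => biprod.desc (S.d 0) s
      | 1 => S.d 1 ≫ biprod.inl
      | i + 2 => S.d (i + 2)
    finGen
      | 0, hi => S.finGen 0 hi
      | 1, hi => (S.finGen 1 hi).biprod hP
      | i + 2, hi => S.finGen (i + 2) hi
    projective
      | 0, hi => S.projective 0 hi
      | 1, hi => have := S.projective 1 hi; inferInstance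
      | i + 2, hi => S.projective (i + 2) hi
    surjective := (epi_iff_surjective (S.ε ≫ biprod.fst)).1 inferInstance
    exact_zero hn a := exact_biprod_desc_comp_fst hs (S.exact_zero hn a)
    exact_succ
      | 0, hi => fun a => exact_comp_biprod_inl (S.exact_succ 0 hi a)
          (biprod_desc_apply_eq_zero_iff hs (S.exact_zero (by lia) a))
      | 1, hi => fun a => exact_biprod_inl_comp (S.exact_succ 1 hi a)
      | i + 2, hi => S.exact_succ (i + 2) hi }⟩

lemma kernel {ι : K ⟶ R} {p : R ⟶ F} (hF : modK A (n + 1) F) (hR : IsFinGen R) [Projective R]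
    (hp : ∀ a, Function.Surjective (p.hom.app a))
    (hιp : ∀ a, Function.Exact (ι.hom.app a) (p.hom.app a))
    (hι : ∀ a, Function.Injective (ι.hom.app a)) : modK A n K := by
  obtain ⟨S⟩ := hF
  have : Projective (S.P 0) := S.projective 0 (by lia)
  exact of_biprod (kernel_biprod S hR hp hιp hι) (S.finGen 0 (by lia))

end modK

end Modules

section Transport

variable {A B : Type u} [Category.{v} A] [Preadditive A] [Category.{v} B] [Preadditive B]

instance : (additiveFunctor A AddCommGrpCat.{v}).IsClosedUnderIsomorphisms where
  of_iso e (_ : Functor.Additive _) := Functor.additive_of_iso e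

/-- Restriction of modules along an additive equivalence, as an equivalence of categories. -/
def precompEquivalence (e : A ≌ B) [e.functor.Additive] :
    (B ⥤+ AddCommGrpCat.{v}) ≌ (A ⥤+ AddCommGrpCat.{v}) :=
  e.symm.congrLeft.congrFullSubcategory (by
    ext F
    refine ⟨fun h => ?_, fun (h : F.Additive) => ?_⟩
    · have : (e.functor ⋙ F).Additive := h
      have : (e.inverse ⋙ e.functor ⋙ F).Additive := inferInstance
      exact Functor.additive_of_iso (e.invFunIdAssoc F)
    · exact inferInstanceAs (e.functor ⋙ F).Additive)

lemma IsFinGen.precompEquivalence {F : B ⥤+ AddCommGrpCat.{v}} (h : IsFinGen F) (e : A ≌ B)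
    [e.functor.Additive] : IsFinGen ((precompEquivalence e).functor.obj F) := by
  obtain ⟨n, b, x, hx⟩ := h
  refine ⟨n, fun i => e.inverse.obj (b i), fun i => F.obj.map (e.counitInv.app (b i)) (x i),
    fun a y => ?_⟩
  obtain ⟨f, hf⟩ := hx (e.functor.obj a) y
  refine ⟨fun i => e.inverse.map (f i) ≫ e.unitInv.app a, hf.trans
    (Finset.sum_congr rfl fun i _ => ?_)⟩
  refine Eq.trans ?_ (map_comp_apply F _ _ (x i))
  simp

lemma modK.precompEquivalence {k : ℕ} {F : B ⥤+ AddCommGrpCat.{v}} (h : modK B k F) (e : A ≌ B)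
    [e.functor.Additive] : modK A k ((precompEquivalence e).functor.obj F) := by
  obtain ⟨S⟩ := h
  exact ⟨{
    P i := (SymPrinciple.precompEquivalence e).functor.obj (S.P i)
    ε := (SymPrinciple.precompEquivalence e).functor.map S.ε
    d i := (SymPrinciple.precompEquivalence e).functor.map (S.d i)
    finGen i hi := (S.finGen i hi).precompEquivalence e
    projective i hi := (Equivalence.map_projective_iff _ _).2 (S.projective i hi)
    surjective a := S.surjective (e.functor.obj a)
    exact_zero hk a := S.exact_zero hk (e.functor.obj a)
    exact_succ i hi a := S.exact_succ i hi (e.functor.obj a) }⟩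

instance (k : ℕ) : (modK A k).IsClosedUnderIsomorphisms where
  of_iso {F G} e := by
    rintro ⟨S⟩
    have : Epi S.ε := (epi_iff_surjective _).2 S.surjective
    have he (a : A) : Function.Injective (e.hom.hom.app a) :=
      Function.LeftInverse.injective (congr_app_apply e.hom_inv_id)
    exact ⟨{
      P := S.P
      ε := S.ε ≫ e.hom
      d := S.d
      finGen := S.finGen
      projective := S.projective
      surjective := (epi_iff_surjective (S.ε ≫ e.hom)).1 inferInstance
      exact_zero hk a x :=
        Iff.trans (map_eq_zero_iff (e.hom.hom.app a).hom (he a)) (S.exact_zero hk a x)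
      exact_succ := S.exact_succ }⟩

/-- The isomorphism of modules with given components. -/
def isoOfAddEquiv {F G : A ⥤+ AddCommGrpCat.{v}} (e : ∀ a, F.obj.obj a ≃+ G.obj.obj a)
    (he : ∀ {a b : A} (f : a ⟶ b) (x : F.obj.obj a),
      e b (F.obj.map f x) = G.obj.map f (e a x)) : F ≅ G :=
  ObjectProperty.isoMk _ (NatIso.ofComponents (fun a => (e a).toAddCommGrpIso)
    fun f => AddCommGrpCat.ext (he f))

end Transport

section HomModules

variable {C : Type u} [Category.{v} C] [Preadditive C] {M : ObjectProperty C}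

/-- Functoriality of `homTo`. -/
noncomputable def homToMap (M : ObjectProperty C) {X Y : C} (f : X ⟶ Y) :
    homTo M X ⟶ homTo M Y :=
  ⟨Functor.whiskerLeft M.ι.op (preadditiveYoneda.map f)⟩

/-- Contravariant functoriality of `homFrom`. -/
noncomputable def homFromMap (M : ObjectProperty C) {X Y : C} (f : X ⟶ Y) :
    homFrom M Y ⟶ homFrom M X :=
  ⟨Functor.whiskerLeft M.ι (preadditiveCoyoneda.map f.op)⟩

/-- The Yoneda module of `N` over `Mᵒᵖ` is `Hom(-, N)|_M`. -/
noncomputable def coyonedaModuleIsoHomTo (N : M.FullSubcategory) :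
    coyonedaModule (Opposite.op N) ≅ homTo M N.obj :=
  isoOfAddEquiv (fun _ =>
    { toFun f := f.unop.hom
      invFun f := Quiver.Hom.op (ObjectProperty.homMk f)
      left_inv _ := rfl
      right_inv _ := rfl
      map_add' _ _ := rfl }) fun _ _ => rfl

/-- The Yoneda module of `N` over `M` is `Hom(N, -)|_M`. -/
noncomputable def coyonedaModuleIsoHomFrom (N : M.FullSubcategory) :
    coyonedaModule N ≅ homFrom M N.obj :=
  isoOfAddEquiv (fun _ =>
    { toFun f := f.hom
      invFun f := ObjectProperty.homMk f
      left_inv _ := rfl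
      right_inv _ := rfl
      map_add' _ _ := rfl }) fun _ _ => rfl

lemma isFinGen_homTo {N : C} (hN : M N) : IsFinGen (homTo M N) :=
  (isFinGen_coyonedaModule _).of_iso (coyonedaModuleIsoHomTo ⟨N, hN⟩)

lemma projective_homTo {N : C} (hN : M N) : Projective (homTo M N) :=
  Projective.of_iso (coyonedaModuleIsoHomTo ⟨N, hN⟩) inferInstance

lemma isFinGen_homFrom {N : C} (hN : M N) : IsFinGen (homFrom M N) :=
  (isFinGen_coyonedaModule _).of_iso (coyonedaModuleIsoHomFrom ⟨N, hN⟩)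

lemma projective_homFrom {N : C} (hN : M N) : Projective (homFrom M N) :=
  Projective.of_iso (coyonedaModuleIsoHomFrom ⟨N, hN⟩) inferInstance

instance : M.opEquivalence.symm.functor.Additive where
  map_add := rfl

instance : M.opEquivalence.leftOp.functor.Additive where
  map_add := rfl

instance [HasFiniteBiproducts M.FullSubcategory] : HasFiniteBiproducts M.op.FullSubcategory := by
  have : HasFiniteCoproducts M.FullSubcategory := inferInstance
  have : HasFiniteProducts M.op.FullSubcategory :=
    ⟨fun _ => Adjunction.hasLimitsOfShape_of_equivalence M.opEquivalence.functor⟩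
  exact HasFiniteBiproducts.of_hasFiniteProducts

/-- The module `Hom(op X, -)|_{M.op}` over the opposite category, viewed over `Mᵒᵖ`, is
`Hom(-, X)|_M`. -/
noncomputable def homFromOpIsoHomTo (M : ObjectProperty C) (X : C) :
    (precompEquivalence M.opEquivalence.symm).functor.obj (homFrom M.op (Opposite.op X)) ≅
      homTo M X :=
  isoOfAddEquiv (fun _ =>
    { toFun f := f.unop
      invFun f := f.op
      left_inv _ := rfl
      right_inv _ := rfl
      map_add' _ _ := rfl }) fun _ _ => rfl

/-- The module `Hom(X, -)|_M`, viewed over the opposite of `M.op`, is `Hom(-, op X)|_{M.op}`. -/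
noncomputable def homFromIsoHomToOp (M : ObjectProperty C) (X : C) :
    (precompEquivalence M.opEquivalence.leftOp).functor.obj (homFrom M X) ≅
      homTo M.op (Opposite.op X) :=
  isoOfAddEquiv (fun _ =>
    { toFun f := f.op
      invFun f := f.unop
      left_inv _ := rfl
      right_inv _ := rfl
      map_add' _ _ := rfl }) fun _ _ => rfl

variable {E : ExactStructure C} {k : ℕ} {X : C}

lemma modK_homFrom_of_cogen (h : E.cogen M k X) : modK M.FullSubcategory k (homFrom M X) := by
  obtain ⟨S, hN, hS⟩ := h
  exact ⟨{
    P i := homFrom M (S.N i)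
    ε := homFromMap M S.η
    d i := homFromMap M (S.d i)
    finGen i hi := isFinGen_homFrom (hN i hi)
    projective i hi := projective_homFrom (hN i hi)
    surjective a := (hS _ a.property).surjective
    exact_zero hk a := (hS _ a.property).exact_zero hk
    exact_succ i hi a := (hS _ a.property).exact_succ i hi }⟩

lemma modK_homTo_of_gen (h : E.gen M k X) : modK M.FullSubcategoryᵒᵖ k (homTo M X) :=
  (modK M.FullSubcategoryᵒᵖ k).prop_of_iso (homFromOpIsoHomTo M X)
    ((modK_homFrom_of_cogen h.op).precompEquivalence M.opEquivalence.symm)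

lemma exists_isBilimit [HasFiniteBiproducts M.FullSubcategory] {N N' : C} (hN : M N)
    (hN' : M N') : ∃ b : BinaryBicone N N', Nonempty b.IsBilimit ∧ M b.pt := by
  have := hasBinaryBiproducts_of_finite_biproducts M.FullSubcategory
  have := preservesBinaryBiproducts_of_preservesBiproducts M.ι
  let B := BinaryBiproduct.bicone (⟨N, hN⟩ : M.FullSubcategory) ⟨N', hN'⟩
  exact ⟨M.ι.mapBinaryBicone B,
    ⟨isBinaryBilimitOfPreserves M.ι (BinaryBiproduct.isBilimit _ _)⟩, B.pt.property⟩

lemma exists_lift_of_isFinGen_homTo [HasFiniteBiproducts M.FullSubcategory]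
    (h : IsFinGen (homTo M X)) :
    ∃ (N : C) (g : N ⟶ X), M N ∧ ∀ T, M T → ∀ f : T ⟶ X, ∃ h : T ⟶ N, h ≫ g = f := by
  obtain ⟨n, a, x, hx⟩ := h
  let x (i : Fin n) : (a i).unop.obj ⟶ X := x i
  let N := ⨁ fun i => (a i).unop
  refine ⟨N.obj, ∑ i, (biproduct.π (fun i => (a i).unop) i).hom ≫ x i, N.property,
    fun T hT f => ?_⟩
  obtain ⟨f, rfl⟩ := hx (Opposite.op ⟨T, hT⟩) f
  refine ⟨(biproduct.lift fun i => (f i).unop).hom, ?_⟩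
  refine (Preadditive.comp_sum _ _ _).trans (Finset.sum_congr rfl fun i _ => ?_)
  rw [← Category.assoc, ← ObjectProperty.FullSubcategory.comp_hom, biproduct.lift_π]
  rfl

lemma modK_homTo_kernel {K N : C} {κ : K ⟶ N} {p : N ⟶ X} (h : E.IsRightApprox M κ p)
    (hX : modK M.FullSubcategoryᵒᵖ (k + 1) (homTo M X)) :
    modK M.FullSubcategoryᵒᵖ k (homTo M K) := by
  have := h.exact.mono
  have := projective_homTo h.mem
  refine hX.kernel (ι := homToMap M κ) (p := homToMap M p) (isFinGen_homTo h.mem)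
    (fun a => h.lift _ a.unop.property) (fun a f => ⟨h.exact.exists_lift f, ?_⟩)
    fun a f g hfg => (cancel_mono κ).1 hfg
  rintro ⟨g, rfl⟩
  exact (Category.assoc _ _ _).trans ((congrArg _ h.exact.zero).trans comp_zero)

namespace ExactStructure

lemma exists_isRightApprox_of_isFinGen [HasBinaryBiproducts C]
    [HasFiniteBiproducts M.FullSubcategory] (hP : E.EnoughProjectives)
    (hcogen : E.projectives ≤ E.cogen M k) (hX : E.FactorsThrough M k X)
    (h : IsFinGen (homTo M X)) :
    ∃ (K N : C) (κ : K ⟶ N) (p : N ⟶ X), E.IsRightApprox M κ p := by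
  obtain ⟨N, g, hN, hg⟩ := exists_lift_of_isFinGen_homTo h
  exact exists_isRightApprox hP (fun _ _ => exists_isBilimit) hcogen hX hN g hg

lemma gen_of_factorsThrough [HasBinaryBiproducts C] [HasFiniteBiproducts M.FullSubcategory]
    (hP : E.EnoughProjectives) {n j : ℕ} (hcogen : E.projectives ≤ E.cogen M (j + n))
    (hX : E.FactorsThrough M j X) (hmod : modK M.FullSubcategoryᵒᵖ n (homTo M X)) :
    E.gen M n X := by
  induction n generalizing j X with
  | zero =>
    obtain ⟨K, N, κ, p, h⟩ := exists_isRightApprox_of_isFinGen hP hcogen hX hmod.isFinGen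
    exact h.gen_zero
  | succ n ih =>
    have hcogen_j := hcogen.trans (cogen_antitone E M (Nat.le_add_right j (n + 1)))
    obtain ⟨K, N, κ, p, h⟩ := exists_isRightApprox_of_isFinGen hP hcogen_j hX hmod.isFinGen
    have hcogen_n : E.projectives ≤ E.cogen M (j + 1 + n) := by rwa [Nat.succ_add_eq_add_succ]
    exact h.gen_succ (ih hcogen_n (hX.succ h) (modK_homTo_kernel h hmod))

lemma injectives_le_gen [HasBinaryBiproducts C] [HasFiniteBiproducts M.FullSubcategory]
    (hP : E.EnoughProjectives) (hcogen : E.projectives ≤ E.cogen M k)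
    (hmod : ∀ I, E.injectives I → modK M.FullSubcategoryᵒᵖ k (homTo M I)) :
    E.injectives ≤ E.gen M k := fun I hI =>
  gen_of_factorsThrough hP (by rwa [Nat.zero_add]) (hI.factorsThrough 0) (hmod I hI)

lemma projectives_le_cogen [HasBinaryBiproducts C] [HasFiniteBiproducts M.FullSubcategory]
    (hI : E.EnoughInjectives) (hgen : E.injectives ≤ E.gen M k)
    (hmod : ∀ P, E.projectives P → modK M.FullSubcategory k (homFrom M P)) :
    E.projectives ≤ E.cogen M k := by
  have hcogen : E.op.projectives ≤ E.op.cogen M.op k := fun I hI => (hgen _ hI.unop).op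
  have hmod : ∀ P, E.op.injectives P → modK M.op.FullSubcategoryᵒᵖ k (homTo M.op P) :=
    fun P hP => (modK _ k).prop_of_iso (homFromIsoHomToOp M P.unop)
      ((hmod _ hP.unop).precompEquivalence M.opEquivalence.leftOp)
  exact fun P hP => (injectives_le_gen hI.op hcogen hmod _ hP.op).unop

end ExactStructure

end HomModules

end SymPrinciple

theorem theorem3 {C : Type u} [Category.{v} C] [Preadditive C] [HasFiniteBiproducts C]
    (E : SymPrinciple.ExactStructure C)
    (hP : E.EnoughProjectives) (hI : E.EnoughInjectives)
    (M : ObjectProperty C) [HasFiniteBiproducts M.FullSubcategory]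
    (k : ℕ) (hk : 1 ≤ k) :
    (E.projectives ≤ E.cogen M k ∧
        ∀ I, E.injectives I →
          SymPrinciple.modK M.FullSubcategoryᵒᵖ k (SymPrinciple.homTo M I)) ↔
      (E.injectives ≤ E.gen M k ∧
        ∀ P, E.projectives P →
          SymPrinciple.modK M.FullSubcategory k (SymPrinciple.homFrom M P)) := by
  have := hasBinaryBiproducts_of_finite_biproducts C
  constructor
  · rintro ⟨hcogen, hmod⟩
    exact ⟨SymPrinciple.ExactStructure.injectives_le_gen hP hcogen hmod,
      fun P h => SymPrinciple.modK_homFrom_of_cogen (hcogen P h)⟩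
  · rintro ⟨hgen, hmod⟩
    exact ⟨SymPrinciple.ExactStructure.projectives_le_cogen hI hgen hmod,
      fun I h => SymPrinciple.modK_homTo_of_gen (hgen I h)⟩
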